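/- Let $S$ be a Lusin space, i.e. a topological space homeomorphic to a Borel subset of a Polish space. **Setting.** For a topological space $E$, let $\mathcal P(E)$ be the set of Borel probability measures on $E$ with the weak topology. Let $D(E)$ be the set of càdlàg functions $[0,1]\to E$. The Meyer–Zheng topology on $D(E)$ is the topology of convergence in measure with respect to $\lambda=\frac12(\mathrm{Leb}+\delta_1)$; in the definition of prediction processes below, $D(\cdot)$ always carries this topology. Put $M_0(E)=E$ and $M_{n+1}(E)=\{f\in D(\mathcal P(M_n(E))): f(1)\text{ is a Dirac measure}\}$, and $M_\infty(E)=\{f\in D(\prod_{n\ge0}\mathcal P(M_n(E))): f(1)\in\prod_{n\geq 0}\delta(M_n(E))\}$, where $\delta(M_n(E))$ is the set of Dirac measures on $M_n(E)$. An $E$-valued filtered random variable is a tuple $\mathbb X=(\Omega,\mathcal F,\mathbb P,(\mathcal F_t)_{t\in[0,1]},X)$ consisting of a probability space with a right-continuous complete filtration and an $\mathcal F_1$-measurable random variable $X:\Omega\to E$. Its prediction process $\mathrm{pp}(\mathbb X)=\mathrm{pp}^1(\mathbb X)$ is the càdlàg version (unique up to indistinguishability) of the measure-valued martingale $(\mathcal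 L(X\mid\mathcal F_t))_{t\in[0,1]}$, an $M_1(E)$-valued random variable. Iterating, $\mathrm{pp}^0(\mathbb X)=X$ and $\mathrm{pp}^{n+1}(\mathbb X)$ is the prediction process of $\mathrm{pp}^n(\mathbb X)$ with respect to the same filtration; finally $\mathrm{pp}^\infty_t(\mathbb X)=(\mathrm{pp}^1_t(\mathbb X),\mathrm{pp}^2_t(\mathbb X),\dots)$. The space $\mathrm{FR}(E)$ of filtered random variables is the set of all $E$-valued filtered random variables modulo the equivalence relation $\mathbb X\approx_\infty\mathbb Y:\iff\mathcal L(\mathrm{pp}^\infty(\mathbb X))=\mathcal L(\mathrm{pp}^\infty(\mathbb Y))$. The Hoover–Keisler topology $\mathrm{HK}_1$ of rank one on $\mathrm{FR}(E)$ is the initial topology with respect to $\mathrm{FR}(E)\to\mathcal P(M_1(E))$, $\mathbb X\mapsto\mathcal L(\mathrm{pp}^1(\mathbb X))$. Let $\mathrm{FP}(S)\subset\mathrm{FR}(D(S))$ be the set of (classes of) filtered processes, i.e. of those $\mathbb X$ for which $X_t$ is $\mathcal F_t$-measurable for every $t\in[0,1]$. Let $C(S)$ be the set of continuous functions $[0,1]\to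 S$ with the topology of the supremum distance, and let $\mathrm{FP}_{\mathrm{cont}}(S)\subset\mathrm{FR}(C(S))$ be the set of (classes of) filtered processes with continuous paths, again characterized by adaptedness of $(X_t)_{t\in[0,1]}$. **Proposition.** 1. If $D(S)$ is equipped with the Meyer–Zheng topology, then $\mathrm{FP}(S)$ is $\mathrm{HK}_1$-closed in $\mathrm{FR}(D(S))$. 2. If $D(S)$ is equipped with the Skorokhod $J_1$-topology, then $\mathrm{FP}(S)$ is $\mathrm{HK}_1$-closed in $\mathrm{FR}(D(S))$. 3. If $C(S)$ is equipped with the supremum distance, then $\mathrm{FP}_{\mathrm{cont}}(S)$ is $\mathrm{HK}_1$-closed in $\mathrm{FR}(C(S))$. -/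

import Mathlib

open MeasureTheory Filter Topology
open scoped unitInterval ENNReal

universe u v

namespace AdaptedWeak

/-! ### Lusin spaces and spaces of probability measures -/

/-- A Lusin space: homeomorphic to a Borel subset of a Polish space. -/
def IsLusin (S : Type u) [TopologicalSpace S] : Prop :=
  ∃ (S' : Type u) (_ : TopologicalSpace S') (_ : PolishSpace S') (ι : S → S'),
    IsEmbedding ι ∧ @MeasurableSet S' (borel S') (Set.range ι)

/-- `PM E` is the set of Borel probability measures on the topological space `E`. -/
def PM (E : Type u) [TopologicalSpace E] : Type u :=
  @ProbabilityMeasure E (borel E)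

/-- `PM E` carries the weak topology (testing against bounded continuous functions). -/
noncomputable instance (E : Type u) [TopologicalSpace E] : TopologicalSpace (PM E) :=
  @ProbabilityMeasure.instTopologicalSpace E (borel E) _ (@OpensMeasurableSpace.mk E _ (borel E) le_rfl)

/-- The measure underlying an element of `PM E`. -/
noncomputable def PM.toMeasure {E : Type u} [TopologicalSpace E] (μ : PM E) :
    @Measure E (borel E) :=
  Subtype.val μ

/-- The Dirac measure at `x`. -/
noncomputable def PM.dirac {E : Type u} [TopologicalSpace E] (x : E) : PM E :=
  letI : MeasurableSpace E := borel E
  (⟨Measure.dirac x, inferInstance⟩ : ProbabilityMeasure E)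

/-! ### Càdlàg paths on `[0,1]`, Meyer–Zheng topology and `J₁` topology -/

/-- Càdlàg functions `[0,1] → E`. -/
structure Cadlag (E : Type u) [TopologicalSpace E] : Type u where
  toFun : I → E
  right_cont : ∀ t, ContinuousWithinAt toFun (Set.Ici t) t
  left_lim : ∀ t, ∃ l, Tendsto toFun (𝓝[<] t) (𝓝 l)

instance (E : Type u) [TopologicalSpace E] : CoeFun (Cadlag E) (fun _ => I → E) :=
  ⟨Cadlag.toFun⟩

/-- A constant path. -/
def Cadlag.const {E : Type u} [TopologicalSpace E] (x : E) : Cadlag E where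
  toFun := fun _ => x
  right_cont := fun _ => continuousWithinAt_const
  left_lim := fun _ => ⟨x, tendsto_const_nhds⟩

/-- The measure `λ = (Leb + δ₁) / 2` on `[0,1]`. -/
noncomputable def lam : Measure I :=
  (2⁻¹ : ℝ≥0∞) • ((volume : Measure I) + Measure.dirac (1 : I))

/-- `ρ` is a continuous pseudometric on the topological space `E`. (If the topology of `E` is
metrizable, every compatible metric is one.) -/
def IsContPseudo {E : Type u} [TopologicalSpace E] (ρ : PseudoMetric E ℝ) : Prop :=
  Continuous (fun p : E × E => ρ p.1 p.2)

theorem IsContPseudo.sup {E : Type u} [TopologicalSpace E] {ρ τ : PseudoMetric E ℝ}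
    (hρ : IsContPseudo ρ) (hτ : IsContPseudo τ) : IsContPseudo (ρ ⊔ τ) := by
  unfold IsContPseudo at *
  simpa using hρ.sup hτ

/-- The paths `h` that are `ε`-close to `f` in `λ`-measure, distances being taken in `ρ`. -/
def mzBall {E : Type u} [TopologicalSpace E] (ρ : PseudoMetric E ℝ) (ε : ℝ) (f : Cadlag E) :
    Set (Cadlag E) :=
  {h | lam {t | ε ≤ ρ (f t) (h t)} < ENNReal.ofReal ε}

theorem mzBall_mono {E : Type u} [TopologicalSpace E] {ρ τ : PseudoMetric E ℝ} {ε δ : ℝ}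
    (h : ρ ≤ τ) (hδ : δ ≤ ε) (f : Cadlag E) : mzBall τ δ f ⊆ mzBall ρ ε f := by
  intro g hg
  refine lt_of_le_of_lt (measure_mono ?_) (lt_of_lt_of_le hg (ENNReal.ofReal_le_ofReal hδ))
  intro t ht
  exact hδ.trans (le_trans ht (h (f t) (g t)))

/-- The paths `h` that are `ε`-close to `f` up to a time change that is `ε`-close to the identity,
distances being taken in `ρ`. -/
def j1Ball {E : Type u} [TopologicalSpace E] (ρ : PseudoMetric E ℝ) (ε : ℝ) (f : Cadlag E) :
    Set (Cadlag E) :=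
  {h | ∃ γ : I ≃o I, ∀ t : I, |(γ t : ℝ) - (t : ℝ)| < ε ∧ ρ (f (γ t)) (h t) < ε}

theorem j1Ball_mono {E : Type u} [TopologicalSpace E] {ρ τ : PseudoMetric E ℝ} {ε δ : ℝ}
    (h : ρ ≤ τ) (hδ : δ ≤ ε) (f : Cadlag E) : j1Ball τ δ f ⊆ j1Ball ρ ε f := by
  rintro g ⟨γ, hγ⟩
  exact ⟨γ, fun t => ⟨(hγ t).1.trans_le hδ,
    lt_of_le_of_lt (h (f (γ t)) (g t)) ((hγ t).2.trans_le hδ)⟩⟩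

/-- The path space `D(E)`, to be equipped with the Meyer–Zheng topology. -/
def DMZ (E : Type u) [TopologicalSpace E] : Type u := Cadlag E

/-- The path space `D(E)`, to be equipped with the `J₁` topology. -/
def DJ1 (E : Type u) [TopologicalSpace E] : Type u := Cadlag E

instance (E : Type u) [TopologicalSpace E] : CoeFun (DMZ E) (fun _ => I → E) :=
  ⟨Cadlag.toFun⟩

instance (E : Type u) [TopologicalSpace E] : CoeFun (DJ1 E) (fun _ => I → E) :=
  ⟨Cadlag.toFun⟩

/-- The Meyer–Zheng topology, i.e. convergence in measure with respect to `λ`. For metrizable `E`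
the topology of convergence in measure does not depend on the compatible metric, and convergence in
measure for a compatible metric implies the one for every continuous pseudometric; letting `ρ` run
through all continuous pseudometrics thus gives this topology without choosing a metric. -/
instance (E : Type u) [TopologicalSpace E] : TopologicalSpace (DMZ E) where
  IsOpen U := ∀ f ∈ U, ∃ ρ : PseudoMetric E ℝ, IsContPseudo ρ ∧ ∃ ε > 0, mzBall ρ ε f ⊆ U
  isOpen_univ := fun _ _ => ⟨⊥, continuous_const, 1, one_pos, Set.subset_univ _⟩
  isOpen_inter := by
    rintro U V hU hV f ⟨hfU, hfV⟩
    obtain ⟨ρ, hρ, ε, hε, h1⟩ := hU f hfU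
    obtain ⟨τ, hτ, δ, hδ, h2⟩ := hV f hfV
    exact ⟨ρ ⊔ τ, hρ.sup hτ, min ε δ, lt_min hε hδ, Set.subset_inter
      ((mzBall_mono le_sup_left (min_le_left _ _) f).trans h1)
      ((mzBall_mono le_sup_right (min_le_right _ _) f).trans h2)⟩
  isOpen_sUnion := by
    rintro 𝒰 h𝒰 f ⟨U, hU, hf⟩
    obtain ⟨ρ, hρ, ε, hε, h⟩ := h𝒰 U hU f hf
    exact ⟨ρ, hρ, ε, hε, h.trans (Set.subset_sUnion_of_mem hU)⟩

/-- The `J₁` topology, i.e. uniform convergence after time changes that converge uniformly to the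
identity. For metrizable `E` it does not depend on the compatible metric, and closeness for a
continuous pseudometric is implied by closeness for a compatible metric since càdlàg paths have
relatively compact range; so again `ρ` may run through all continuous pseudometrics. -/
instance (E : Type u) [TopologicalSpace E] : TopologicalSpace (DJ1 E) where
  IsOpen U := ∀ f ∈ U, ∃ ρ : PseudoMetric E ℝ, IsContPseudo ρ ∧ ∃ ε > 0, j1Ball ρ ε f ⊆ U
  isOpen_univ := fun _ _ => ⟨⊥, continuous_const, 1, one_pos, Set.subset_univ _⟩
  isOpen_inter := by
    rintro U V hU hV f ⟨hfU, hfV⟩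
    obtain ⟨ρ, hρ, ε, hε, h1⟩ := hU f hfU
    obtain ⟨τ, hτ, δ, hδ, h2⟩ := hV f hfV
    exact ⟨ρ ⊔ τ, hρ.sup hτ, min ε δ, lt_min hε hδ, Set.subset_inter
      ((j1Ball_mono le_sup_left (min_le_left _ _) f).trans h1)
      ((j1Ball_mono le_sup_right (min_le_right _ _) f).trans h2)⟩
  isOpen_sUnion := by
    rintro 𝒰 h𝒰 f ⟨U, hU, hf⟩
    obtain ⟨ρ, hρ, ε, hε, h⟩ := h𝒰 U hU f hf
    exact ⟨ρ, hρ, ε, hε, h.trans (Set.subset_sUnion_of_mem hU)⟩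

/-- Composition of a càdlàg path with a continuous map. -/
def DMZ.map {E F : Type u} [TopologicalSpace E] [TopologicalSpace F] (φ : E → F)
    (hφ : Continuous φ) (f : DMZ E) : DMZ F where
  toFun := fun t => φ (f t)
  right_cont := fun t => hφ.continuousAt.comp_continuousWithinAt (f.right_cont t)
  left_lim := fun t => by
    obtain ⟨l, hl⟩ := f.left_lim t
    exact ⟨φ l, (hφ.tendsto l).comp hl⟩

/-- Composition with a continuous map is continuous for the Meyer–Zheng topologies. -/
theorem DMZ.continuous_map {E F : Type u} [TopologicalSpace E] [TopologicalSpace F] (φ : E → F)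
    (hφ : Continuous φ) : Continuous (DMZ.map φ hφ) := by
  refine ⟨fun U hU f hf => ?_⟩
  obtain ⟨ρ, hρ, ε, hε, h⟩ := hU _ hf
  refine ⟨⟨fun x y => ρ (φ x) (φ y), fun x => ρ.refl _, fun x y => ρ.symm _ _,
    fun x y z => ρ.triangle _ _ _⟩, ?_, ε, hε, fun g hg => h hg⟩
  exact Continuous.comp hρ ((hφ.comp continuous_fst).prodMk (hφ.comp continuous_snd))

/-! ### The path spaces of the iterated prediction processes -/

/-- For `E = Mₙ`, the next space `Mₙ₊₁ = {f ∈ D(P(E)) : f(1) is a Dirac measure}`, where `D(P(E))`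
carries the Meyer–Zheng topology and `Mₙ₊₁` the subspace topology. -/
def Next (E : Type u) [TopologicalSpace E] : Type u :=
  {f : DMZ (PM E) // f 1 ∈ Set.range (PM.dirac : E → PM E)}

instance (E : Type u) [TopologicalSpace E] : TopologicalSpace (Next E) :=
  inferInstanceAs (TopologicalSpace {f : DMZ (PM E) // f 1 ∈ Set.range (PM.dirac : E → PM E)})

/-- The spaces `M₀ = E`, `Mₙ₊₁ = {f ∈ D(P(Mₙ)) : f(1) ∈ δ(Mₙ)}`. -/
noncomputable def M (E : Type u) [TopologicalSpace E] : ℕ → TopCat.{u}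
  | 0 => TopCat.of E
  | n + 1 => TopCat.of (Next (M E n))

/-- The space `M_∞ = {f ∈ D(∏ₙ P(Mₙ)) : f(1) ∈ ∏ₙ δ(Mₙ)}`, with the subspace topology of the
Meyer–Zheng topology. -/
def MInf (E : Type u) [TopologicalSpace E] : Type u :=
  {f : DMZ (∀ n : ℕ, PM (M E n)) // ∀ n, f 1 n ∈ Set.range (PM.dirac : M E n → PM (M E n))}

instance (E : Type u) [TopologicalSpace E] : TopologicalSpace (MInf E) :=
  inferInstanceAs (TopologicalSpace {f : DMZ (∀ n : ℕ, PM (M E n)) //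
    ∀ n, f 1 n ∈ Set.range (PM.dirac : M E n → PM (M E n))})

/-- The coordinate map `M_∞ → Mₙ₊₁`. -/
noncomputable def MInf.proj {E : Type u} [TopologicalSpace E] (n : ℕ) (f : MInf E) : Next (M E n) :=
  ⟨DMZ.map (fun z : ∀ n : ℕ, PM (M E n) => z n) (continuous_apply n) f.1, f.2 n⟩

theorem MInf.continuous_proj {E : Type u} [TopologicalSpace E] (n : ℕ) :
    Continuous (MInf.proj n : MInf E → Next (M E n)) :=
  Continuous.subtype_mk ((DMZ.continuous_map
    (fun z : ∀ n : ℕ, PM (M E n) => z n) (continuous_apply n)).comp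
    continuous_subtype_val) _

/-! ### Filtered random variables -/

/-- A filtered probability space `(Ω, 𝓕, P, (𝓕ₜ)_{t ∈ [0,1]})` satisfying the usual conditions:
the filtration is right-continuous and `𝓕₀` contains all subsets of `P`-null sets. -/
structure FiltSpace : Type (v + 1) where
  Ω : Type v
  mΩ : MeasurableSpace Ω
  P : Measure Ω
  isProb : IsProbabilityMeasure P
  𝓕 : Filtration I mΩ
  right_cont : 𝓕.IsRightContinuous
  complete : ∀ A : Set Ω, P A = 0 → MeasurableSet[𝓕 0] A

instance (B : FiltSpace.{v}) : MeasurableSpace B.Ω := B.mΩ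

instance (B : FiltSpace.{v}) : IsProbabilityMeasure B.P := B.isProb

/-- `E`-valued random variables on a filtered probability space, measurable with respect to `𝓕₁`
and the Borel `σ`-algebra of `E`. -/
structure RV (B : FiltSpace.{v}) (E : Type u) [TopologicalSpace E] where
  toFun : B.Ω → E
  meas : @Measurable B.Ω E (B.𝓕 1) (borel E) toFun

instance (B : FiltSpace.{v}) (E : Type u) [TopologicalSpace E] :
    CoeFun (RV B E) (fun _ => B.Ω → E) :=
  ⟨RV.toFun⟩

/-- The law of a random variable. -/
noncomputable def RV.law {B : FiltSpace.{v}} {E : Type u} [TopologicalSpace E] (X : RV B E) :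
    PM E :=
  letI : MeasurableSpace E := borel E
  (⟨B.P.map X, Measure.isProbabilityMeasure_map (X.meas.mono (B.𝓕.le 1) le_rfl).aemeasurable⟩ :
    ProbabilityMeasure E)

/-- An `E`-valued filtered random variable `(Ω, 𝓕, P, (𝓕ₜ), X)` in continuous time. -/
structure FRV (E : Type u) [TopologicalSpace E] where
  base : FiltSpace.{v}
  X : RV base E

/-! ### Prediction processes -/

/-- `Z` is a càdlàg version of the measure-valued martingale `(L(X | 𝓕ₜ))_{t ∈ [0,1]}`: it is
adapted, and `Zₜ(A) = P(X ∈ A | 𝓕ₜ)` almost surely for all `t` and all Borel sets `A`. -/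
def IsPrediction {B : FiltSpace.{v}} {E : Type u} [TopologicalSpace E] (X : RV B E)
    (Z : RV B (Next E)) : Prop :=
  ∀ t : I,
    @Measurable B.Ω (PM E) (B.𝓕 t) (borel (PM E)) (fun ω => (Z ω).1 t) ∧
    ∀ A : Set E, @MeasurableSet E (borel E) A →
      (fun ω => ((Z ω).1 t).toMeasure.real A)
        =ᵐ[B.P] B.P[(X ⁻¹' A).indicator (fun _ => (1 : ℝ)) | B.𝓕 t]

theorem FiltSpace.nonempty (B : FiltSpace.{v}) : Nonempty B.Ω :=
  nonempty_of_isProbabilityMeasure B.P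

/-- A constant random variable, only used as a default value. -/
noncomputable def RV.default {B : FiltSpace.{v}} {E : Type u} [TopologicalSpace E] (X : RV B E) :
    RV B (Next E) where
  toFun := fun _ => ⟨(Cadlag.const (PM.dirac (X B.nonempty.some)) : Cadlag (PM E)), ⟨_, rfl⟩⟩
  meas := @measurable_const _ _ (borel (Next E)) (B.𝓕 1) _

open Classical in
/-- The prediction process `pp(X)`: the càdlàg version, unique up to indistinguishability, of
`(L(X | 𝓕ₜ))_{t ∈ [0,1]}`. -/
noncomputable def RV.pp {B : FiltSpace.{v}} {E : Type u} [TopologicalSpace E] (X : RV B E) :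
    RV B (Next E) :=
  if h : ∃ Z : RV B (Next E), IsPrediction X Z then h.choose else X.default

/-- The iterated prediction processes `pp⁰(X) = X`, `ppⁿ⁺¹(X) = pp(ppⁿ(X))`. -/
noncomputable def RV.ppIter {B : FiltSpace.{v}} {E : Type u} [TopologicalSpace E] (X : RV B E) :
    (n : ℕ) → RV B (M E n)
  | 0 => X
  | n + 1 => (RV.ppIter X n).pp

/-- The path of `pp^{n+1}(X)` as an element of `Mₙ₊₁`. -/
noncomputable def RV.ppPath {B : FiltSpace.{v}} {E : Type u} [TopologicalSpace E] (X : RV B E)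
    (n : ℕ) (ω : B.Ω) : Next (M E n) :=
  X.ppIter (n + 1) ω

/-- The prediction process of infinite order, `pp^∞ₜ(X) = (pp¹ₜ(X), pp²ₜ(X), …)`. -/
noncomputable def RV.ppInf {B : FiltSpace.{v}} {E : Type u} [TopologicalSpace E] (X : RV B E)
    (ω : B.Ω) : MInf E :=
  ⟨({ toFun := fun t n => (X.ppPath n ω).1 t
      right_cont := fun t => tendsto_pi_nhds.2 fun n => (X.ppPath n ω).1.right_cont t
      left_lim := fun t => ⟨fun n => ((X.ppPath n ω).1.left_lim t).choose,
        tendsto_pi_nhds.2 fun n => ((X.ppPath n ω).1.left_lim t).choose_spec⟩ } :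
      Cadlag (∀ n : ℕ, PM (M E n))),
    fun n => (X.ppPath n ω).2⟩

/-! ### The space of filtered random variables -/

/-- `X ≈_∞ Y`: the laws of `pp^∞(X)` and `pp^∞(Y)` on the Borel sets of `M_∞` coincide. -/
def FRV.Equiv {E : Type u} [TopologicalSpace E] (X Y : FRV.{u, v} E) : Prop :=
  ∀ A : Set (MInf E), @MeasurableSet (MInf E) (borel (MInf E)) A →
    X.base.P (X.X.ppInf ⁻¹' A) = Y.base.P (Y.X.ppInf ⁻¹' A)

instance FRV.setoid (E : Type u) [TopologicalSpace E] : Setoid (FRV.{u, v} E) where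
  r := FRV.Equiv
  iseqv := ⟨fun _ _ _ => rfl, fun h A hA => (h A hA).symm,
    fun h h' A hA => (h A hA).trans (h' A hA)⟩

/-- The space `FR(E)` of `E`-valued filtered random variables, the factor space by `≈_∞`. -/
def FR (E : Type u) [TopologicalSpace E] : Type (max u (v + 1)) :=
  Quotient (FRV.setoid.{u, v} E)

theorem FRV.law_pp_eq {E : Type u} [TopologicalSpace E] {X Y : FRV.{u, v} E} (h : X.Equiv Y) :
    X.X.pp.law = Y.X.pp.law := by
  let _ : MeasurableSpace (Next E) := borel (Next E)
  refine Subtype.ext (Measure.ext fun A hA => ?_)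
  have hX : Measurable X.X.pp.toFun := X.X.pp.meas.mono (X.base.𝓕.le 1) le_rfl
  have hY : Measurable Y.X.pp.toFun := Y.X.pp.meas.mono (Y.base.𝓕.le 1) le_rfl
  change X.base.P.map X.X.pp.toFun A = Y.base.P.map Y.X.pp.toFun A
  rw [Measure.map_apply hX hA, Measure.map_apply hY hA]
  have hm : @MeasurableSet (MInf E) (borel (MInf E)) (MInf.proj 0 ⁻¹' A) := by
    exact (MInf.continuous_proj (E := E) 0).borel_measurable hA
  exact h _ hm

/-- The map `FR(E) → P(M₁)`, `X ↦ L(pp¹(X))`. -/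
noncomputable def FR.lawPP1 {E : Type u} [TopologicalSpace E] : FR.{u, v} E → PM (Next E) :=
  Quotient.lift (fun X : FRV.{u, v} E => X.X.pp.law) (fun _ _ h => FRV.law_pp_eq h)

/-- The Hoover–Keisler topology `HK₁` of rank one on `FR(E)`: the initial topology with respect to
`X ↦ L(pp¹(X)) ∈ P(M₁)`. -/
@[reducible]
noncomputable def HK1 (E : Type u) [TopologicalSpace E] : TopologicalSpace (FR.{u, v} E) :=
  TopologicalSpace.induced FR.lawPP1 inferInstance

/-! ### Filtered processes -/

/-- A path-space-valued filtered random variable is a filtered process if the process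
`(Xₜ)_{t ∈ [0,1]}` is adapted; `ev f t` stands for `f(t)`. -/
def FRV.IsAdapted {E S : Type u} [TopologicalSpace E] [TopologicalSpace S] (ev : E → I → S)
    (X : FRV.{u, v} E) : Prop :=
  ∀ t : I, @Measurable X.base.Ω S (X.base.𝓕 t) (borel S) (fun ω => ev (X.X ω) t)

/-- `FP(S)` as a subset of `FR(D(S))`, `D(S)` carrying the Meyer–Zheng topology. -/
def FPMZ (S : Type u) [TopologicalSpace S] : Set (FR.{u, v} (DMZ S)) :=
  {q | ∃ X : FRV.{u, v} (DMZ S), X.IsAdapted (fun f t => f t) ∧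
    q = Quotient.mk (FRV.setoid (DMZ S)) X}

/-- `FP(S)` as a subset of `FR(D(S))`, `D(S)` carrying the `J₁` topology. -/
def FPJ1 (S : Type u) [TopologicalSpace S] : Set (FR.{u, v} (DJ1 S)) :=
  {q | ∃ X : FRV.{u, v} (DJ1 S), X.IsAdapted (fun f t => f t) ∧
    q = Quotient.mk (FRV.setoid (DJ1 S)) X}

/-- The filtered processes with continuous paths as a subset of `FR(C(S))`, where `C(S) = C(I, S)`
carries the compact-open topology; as `[0,1]` is compact, this is the topology of the supremum
distance for every compatible metric on `S`. -/
def FPCont (S : Type u) [TopologicalSpace S] : Set (FR.{u, v} C(I, S)) :=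
  {q | ∃ X : FRV.{u, v} C(I, S), X.IsAdapted (fun f t => f t) ∧
    q = Quotient.mk (FRV.setoid C(I, S)) X}

end AdaptedWeak

namespace AdaptedWeak

open Set BoundedContinuousFunction


/-! ### Right-continuous functions on the unit interval -/

/-! Adaptedness can be read off from continuous functionals of the law of the first prediction
process. For a path-valued `X`, a bounded continuous `φ` and `s ≤ t`, put `F(x) = ∫ₛᵗ φ(xᵣ) λ(dr)`.
If `X` is adapted, then `F(X)` is `𝓕ₜ`-measurable. Conversely, measurability of all these integrals
gives adaptedness: `φ(Xₜ)` is a limit of averages over intervals shrinking to `t` from the right,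
and the filtration is right-continuous.

Let `Z` be the prediction process of `X`. The variable `F(X)` is `𝓕ₜ`-measurable exactly when its
conditional variance `Var_{Zₜ}(F)` vanishes almost surely, and then `Var_{Zᵣ}(F) = 0` for all `r ≥
t` as well. Evaluation at `t` is not continuous for convergence in measure, but `z ↦ ∫ₜ¹ Var_{zᵣ}(F)
λ(dr)` is, because `μ ↦ Var_μ(F)` is bounded and continuous. By nonnegativity and right-continuity
of paths, its expectation vanishes if and only if `Var_{Zₜ}(F) = 0` almost surely. That expectation
is a continuous function of the law of `Z`, so the filtered processes form an intersection of
`HK₁`-closed sets (`IsPathSpace.mem_iff`, `IsPathSpace.isClosed`).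

The topology on paths enters only through the continuity of `F`, which is checked separately for the
three path spaces. One degenerate case remains: where no càdlàg version of the conditional laws
exists, `RV.pp` is a constant Dirac path. The class is then that of a deterministic, hence adapted,
variable (`FRV.equiv_const`). -/

/-- The right end point of the `k`-th cell of the `n`-th uniform grid. -/
noncomputable def gridPoint (n k : ℕ) : I :=
  -- Truncation at `1` keeps the point in `[0,1]` and makes the cell of `t = 1` end at `1` itself,
  -- where the atom of `λ` sits.
  ⟨min 1 ((k + 1) / ((n : ℝ) + 1)), by positivity, min_le_left _ _⟩

/-- The right end point of the cell of the `n`-th uniform grid that contains `t`. -/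
noncomputable def gridRight (n : ℕ) (t : I) : I :=
  gridPoint n ⌊((n : ℝ) + 1) * t⌋₊

theorem self_lt_cell (n : ℕ) (t : I) :
    (t : ℝ) < (⌊((n : ℝ) + 1) * t⌋₊ + 1) / ((n : ℝ) + 1) := by
  rw [lt_div_iff₀ (by positivity), mul_comm]
  exact Nat.lt_floor_add_one _

theorem le_gridRight (n : ℕ) (t : I) : t ≤ gridRight n t :=
  Subtype.coe_le_coe.1 (le_min t.2.2 (self_lt_cell n t).le)

theorem lt_gridRight (n : ℕ) {t : I} (ht : t < 1) : t < gridRight n t :=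
  Subtype.coe_lt_coe.1 (lt_min (by exact_mod_cast ht) (self_lt_cell n t))

theorem gridRight_one (n : ℕ) : gridRight n 1 = 1 :=
  le_antisymm (gridRight n 1).2.2 (le_gridRight n 1)

theorem gridRight_le (n : ℕ) (t : I) : (gridRight n t : ℝ) ≤ t + 1 / ((n : ℝ) + 1) := by
  refine (min_le_right _ _).trans ?_
  rw [add_div]
  gcongr
  rw [div_le_iff₀ (by positivity), mul_comm (t : ℝ)]
  exact Nat.floor_le (mul_nonneg (by positivity) t.2.1)

theorem tendsto_gridRight (t : I) : Tendsto (fun n => gridRight n t) atTop (𝓝[≥] t) := by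
  refine tendsto_nhdsWithin_iff.2 ⟨?_, Eventually.of_forall fun n => le_gridRight n t⟩
  rw [tendsto_subtype_rng]
  refine tendsto_of_tendsto_of_tendsto_of_le_of_le tendsto_const_nhds ?_
    (fun n => Subtype.coe_le_coe.2 (le_gridRight n t)) (fun n => gridRight_le n t)
  simpa using tendsto_one_div_add_atTop_nhds_zero_nat.const_add (t : ℝ)

theorem measurable_comp_gridRight {Ω : Type*} [MeasurableSpace Ω] {g : I → Ω → ℝ} (n : ℕ)
    (hm : ∀ t, Measurable (g t)) : Measurable (fun p : I × Ω => g (gridRight n p.1) p.2) := by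
  -- The grid point depends on `t` only through an integer, so joint measurability reduces to a
  -- countable first factor.
  have h1 : Measurable (fun q : ℕ × Ω => g (gridPoint n q.1) q.2) :=
    measurable_from_prod_countable_right fun k => hm (gridPoint n k)
  have h2 : Measurable (fun p : I × Ω => ⌊((n : ℝ) + 1) * p.1⌋₊) := by
    have h3 : Measurable (fun p : I × Ω => ((n : ℝ) + 1) * p.1) :=
      measurable_const.mul measurable_fst.subtype_val
    exact Nat.measurable_floor.comp h3
  exact h1.comp (h2.prodMk measurable_snd)

/-- A process with right-continuous paths is jointly measurable. -/
theorem measurable_uncurry_of_right_cont {Ω : Type*} [MeasurableSpace Ω] {g : I → Ω → ℝ}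
    (hr : ∀ ω t, ContinuousWithinAt (fun s => g s ω) (Ici t) t) (hm : ∀ t, Measurable (g t)) :
    Measurable (fun p : I × Ω => g p.1 p.2) := by
  have ht (p : I × Ω) : Tendsto (fun n => g (gridRight n p.1) p.2) atTop (𝓝 (g p.1 p.2)) := by
    have h := hr p.2 p.1
    unfold ContinuousWithinAt at h
    exact h.comp (tendsto_gridRight p.1)
  exact measurable_of_tendsto_metrizable (fun n => measurable_comp_gridRight n hm)
    (tendsto_pi_nhds.2 ht)

theorem measurable_of_right_cont {g : I → ℝ} (hr : ∀ t, ContinuousWithinAt g (Ici t) t) :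
    Measurable g :=
  (measurable_uncurry_of_right_cont (Ω := Unit) (g := fun t _ => g t) (fun _ => hr)
    (fun _ => measurable_const)).comp (f := fun t : I => (t, ())) (by fun_prop)

/-- Two right-continuous functions agreeing on a dense set containing `1` agree. -/
theorem eq_of_right_cont {g : I → ℝ} (hg : ∀ t, ContinuousWithinAt g (Ici t) t)
    {D : Set I} (hD : Dense D) (h1 : (1 : I) ∈ D) {c : ℝ} (h : ∀ t ∈ D, g t = c) (t : I) :
    g t = c := by
  rcases eq_or_lt_of_le t.2.2 with h' | h'
  · exact (Subtype.ext h' : t = 1) ▸ h 1 h1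
  have hlt : t < 1 := h'
  by_contra hne
  have h2 := (hg t).eventually_ne hne
  have h3 : ∀ᶠ s in 𝓝[>] t, g s ≠ c := h2.filter_mono (nhdsWithin_mono _ Ioi_subset_Ici_self)
  obtain ⟨u, hu, hs⟩ := (mem_nhdsGT_iff_exists_Ioo_subset' hlt).1 h3
  obtain ⟨d, hd, hdu⟩ := hD.exists_between hu
  exact hs hdu (h d hd)

/-! ### The measure `λ` and averages of right-continuous functions -/

instance : IsFiniteMeasure lam := by
  unfold lam
  exact Measure.smul_finite _ (by simp)

/-- A nondegenerate interval has positive length; an interval ending at `1` is charged by the atom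
even if it is the single point `1`. Averages can thus recover the value at `1` too. -/
theorem lam_Icc_ne_zero {s t : I} (h : s < t ∨ t = 1) (hst : s ≤ t) : lam (Icc s t) ≠ 0 := by
  unfold lam
  simp only [Measure.smul_apply, Measure.add_apply, smul_eq_mul, ne_eq, mul_eq_zero,
    ENNReal.inv_eq_zero, ENNReal.ofNat_ne_top, add_eq_zero, false_or, not_and]
  intro h0
  rcases h with h | rfl
  · rw [unitInterval.volume_Icc] at h0
    simp only [ENNReal.ofReal_eq_zero, sub_nonpos, Subtype.coe_le_coe] at h0
    exact absurd h (not_lt.2 h0)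
  · simp [hst]

theorem lam_gridRight_ne_zero (n : ℕ) (t : I) : lam (Icc t (gridRight n t)) ≠ 0 := by
  refine lam_Icc_ne_zero ?_ (le_gridRight n t)
  rcases eq_or_lt_of_le (show t ≤ 1 from t.2.2) with rfl | h
  · exact Or.inr (gridRight_one n)
  · exact Or.inl (lt_gridRight n h)

theorem integrable_lam_of_right_cont {g : I → ℝ} (hg : ∀ t, ContinuousWithinAt g (Ici t) t)
    {C : ℝ} (hC : ∀ t, |g t| ≤ C) : Integrable g lam :=
  Integrable.of_bound (measurable_of_right_cont hg).aestronglyMeasurable C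
    (Eventually.of_forall hC)

/-- The averages of a right-continuous function over small intervals converge to its value. -/
theorem tendsto_average_of_right_cont {g : I → ℝ} (hg : ∀ t, ContinuousWithinAt g (Ici t) t)
    {C : ℝ} (hC : ∀ t, |g t| ≤ C) (t : I) :
    Tendsto (fun n => (lam.real (Icc t (gridRight n t)))⁻¹ *
      ∫ r in Icc t (gridRight n t), g r ∂lam) atTop (𝓝 (g t)) := by
  rw [Metric.tendsto_atTop']
  intro ε hε
  have h1 : ∀ᶠ s in 𝓝[≥] t, |g s - g t| < ε / 2 :=
    (Metric.tendsto_nhds.1 (hg t).tendsto) _ (by positivity)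
  -- The estimate has to hold on whole intervals `[t, u]`, since it is integrated over them.
  have h2 : ∀ᶠ u in 𝓝[≥] t, ∀ s ∈ Icc t u, |g s - g t| < ε / 2 := by
    rw [eventually_nhdsWithin_iff] at h1 ⊢
    obtain ⟨δ, hδ, hb⟩ := Metric.eventually_nhds_iff.1 h1
    refine Metric.eventually_nhds_iff.2 ⟨δ, hδ, fun u hu hut s hs => hb ?_ hs.1⟩
    refine lt_of_le_of_lt ?_ hu
    rw [Subtype.dist_eq, Subtype.dist_eq, Real.dist_eq, Real.dist_eq]
    have a1 : (t : ℝ) ≤ s := hs.1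
    have a2 : (s : ℝ) ≤ u := hs.2
    rw [abs_of_nonneg (by linarith), abs_of_nonneg (by linarith)]
    linarith
  obtain ⟨N, hN⟩ := eventually_atTop.1 ((tendsto_gridRight t).eventually h2)
  refine ⟨N, fun n hn => ?_⟩
  set J := Icc t (gridRight n t)
  have hpos : 0 < lam.real J :=
    ENNReal.toReal_pos (lam_gridRight_ne_zero n t) (measure_ne_top _ _)
  have hi : Integrable g (lam.restrict J) := (integrable_lam_of_right_cont hg hC).restrict
  have h3 : ∫ r in J, (g r - g t) ∂lam = (∫ r in J, g r ∂lam) - lam.real J * g t := by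
    rw [integral_sub hi (integrable_const _)]
    simp
  have h4 : ‖∫ r in J, (g r - g t) ∂lam‖ ≤ ε / 2 * lam.real J :=
    norm_setIntegral_le_of_norm_le_const (measure_lt_top _ _)
      fun r hr => (hN n hn.le r hr).le
  rw [Real.dist_eq]
  have h5 : (lam.real J)⁻¹ * (∫ r in J, g r ∂lam) - g t
      = (lam.real J)⁻¹ * ∫ r in J, (g r - g t) ∂lam := by
    rw [h3]; field_simp
  rw [h5, abs_mul, abs_of_pos (inv_pos.2 hpos)]
  calc (lam.real J)⁻¹ * |∫ r in J, (g r - g t) ∂lam|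
      ≤ (lam.real J)⁻¹ * (ε / 2 * lam.real J) := by gcongr; exact h4
    _ = ε / 2 := by field_simp
    _ < ε := by linarith

/-- A nonnegative right-continuous function whose integral over `[t,1]` vanishes is zero at `t`. -/
theorem eq_zero_of_integral_eq_zero {g : I → ℝ} (hg : ∀ t, ContinuousWithinAt g (Ici t) t)
    {C : ℝ} (hC : ∀ t, |g t| ≤ C) (h0 : ∀ t, 0 ≤ g t) {t : I}
    (h : ∫ r in Icc t 1, g r ∂lam = 0) : g t = 0 := by
  refine tendsto_nhds_unique (tendsto_average_of_right_cont hg hC t)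
    (tendsto_const_nhds.congr fun n => ?_)
  have h1 : ∫ r in Icc t (gridRight n t), g r ∂lam ≤ ∫ r in Icc t 1, g r ∂lam :=
    setIntegral_mono_set (integrable_lam_of_right_cont hg hC).integrableOn
      (Eventually.of_forall h0) (Icc_subset_Icc_right (show gridRight n t ≤ 1 from (gridRight n t).2.2)).eventuallyLE
  have h2 : 0 ≤ ∫ r in Icc t (gridRight n t), g r ∂lam := integral_nonneg h0
  rw [show ∫ r in Icc t (gridRight n t), g r ∂lam = 0 by linarith, mul_zero]


/-! ### Variances under a varying probability measure -/

section PM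

variable {E : Type u} [TopologicalSpace E]

instance (μ : PM E) : IsProbabilityMeasure μ.toMeasure :=
  let _ : MeasurableSpace E := borel E
  Subtype.property (p := fun ν : Measure E => IsProbabilityMeasure ν) μ

/-- Integration of a bounded continuous function, as a function of the probability measure. -/
noncomputable def PM.integral (F : E →ᵇ ℝ) : PM E →ᵇ ℝ :=
  .ofNormedAddCommGroup (fun μ => ∫ x, F x ∂μ.toMeasure)
    (by
      let _ : MeasurableSpace E := borel E
      have _ : BorelSpace E := ⟨rfl⟩
      exact ProbabilityMeasure.continuous_integral_boundedContinuousFunction F)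
    ‖F‖ fun μ => by
      refine (norm_integral_le_of_norm_le_const
        (Eventually.of_forall fun x => F.norm_coe_le_norm x)).trans (le_of_eq ?_)
      simp

theorem PM.integral_apply (F : E →ᵇ ℝ) (μ : PM E) : PM.integral F μ = ∫ x, F x ∂μ.toMeasure := rfl

/-- The variance of a bounded continuous function, as a function of the probability measure. -/
noncomputable def PM.variance (F : E →ᵇ ℝ) : PM E →ᵇ ℝ :=
  PM.integral (F * F) - PM.integral F * PM.integral F

theorem PM.memLp (F : E →ᵇ ℝ) (μ : PM E) : MemLp F 2 μ.toMeasure := by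
  let _ : MeasurableSpace E := borel E
  have _ : BorelSpace E := ⟨rfl⟩
  exact MemLp.of_bound (F.continuous.measurable.aestronglyMeasurable) ‖F‖
    (Eventually.of_forall fun x => F.norm_coe_le_norm x)

theorem PM.variance_apply (F : E →ᵇ ℝ) (μ : PM E) :
    PM.variance F μ = ProbabilityTheory.variance F μ.toMeasure := by
  rw [ProbabilityTheory.variance_eq_sub (PM.memLp F μ)]
  simp [PM.variance, PM.integral_apply, pow_two]

theorem PM.variance_nonneg (F : E →ᵇ ℝ) (μ : PM E) : 0 ≤ PM.variance F μ := by
  rw [PM.variance_apply]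
  exact ProbabilityTheory.variance_nonneg _ _

/-- This expresses that `F` is deterministic under `μ` as the vanishing of a continuous function of
`μ`. -/
theorem PM.variance_eq_zero_iff (F : E →ᵇ ℝ) (μ : PM E) :
    PM.variance F μ = 0 ↔ ∃ c, ∀ᵐ x ∂μ.toMeasure, F x = c := by
  constructor
  · intro h
    rw [PM.variance_apply, ← ENNReal.toReal_ofReal (ProbabilityTheory.variance_nonneg _ _),
      (PM.memLp F μ).ofReal_variance_eq, ENNReal.toReal_eq_zero_iff] at h
    refine ⟨_, (ProbabilityTheory.evariance_eq_zero_iff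
      (PM.memLp F μ).aestronglyMeasurable.aemeasurable).1
      (h.resolve_right (PM.memLp F μ).evariance_lt_top.ne)⟩
  · rintro ⟨c, hc⟩
    rw [PM.variance_apply, ProbabilityTheory.variance_congr (Y := fun _ => c) hc]
    simp [ProbabilityTheory.variance, ProbabilityTheory.evariance]

/-- The almost sure statement concerns outer measure, so the singleton `{x}` need not be Borel. -/
theorem PM.ext_of_ae_eq {μ : PM E} {x : E}
    (h : ∀ᵐ y ∂μ.toMeasure, y = x) : μ = PM.dirac x := by
  let _ : MeasurableSpace E := borel E
  have _ : BorelSpace E := ⟨rfl⟩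
  refine Subtype.ext (Measure.ext fun A hA => ?_)
  change μ.toMeasure A = Measure.dirac x A
  rw [Measure.dirac_apply' _ hA]
  by_cases hxA : x ∈ A
  · rw [indicator_of_mem hxA, Pi.one_apply]
    exact (prob_compl_eq_zero_iff hA).1 (h.mono fun y hy => hy ▸ hxA)
  · rw [indicator_of_notMem hxA]
    exact measure_mono_null (fun y hy (hyx : y = x) => hxA (hyx ▸ hy)) h

end PM

/-! ### Time integrals along paths -/

theorem Cadlag.comp_right_cont {E : Type u} [TopologicalSpace E] (φ : E →ᵇ ℝ) (f : Cadlag E)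
    (t : I) : ContinuousWithinAt (fun s => φ (f s)) (Ici t) t :=
  φ.continuous.continuousAt.comp_continuousWithinAt (f.right_cont t)

/-- The pseudometric induced by a real function. -/
def pseudoOf {E : Type u} (φ : E → ℝ) : PseudoMetric E ℝ :=
  ⟨fun x y => |φ x - φ y|, fun x => by simp, fun x y => abs_sub_comm _ _,
    fun x y z => abs_sub_le _ _ _⟩

theorem isContPseudo_pseudoOf {E : Type u} [TopologicalSpace E] {φ : E → ℝ} (hφ : Continuous φ) :
    IsContPseudo (pseudoOf φ) :=
  ((hφ.comp continuous_fst).sub (hφ.comp continuous_snd)).abs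

theorem DMZ.continuous_of_mzBall {E : Type u} [TopologicalSpace E] {F : DMZ E → ℝ}
    (h : ∀ f : DMZ E, ∀ δ > 0, ∃ ρ : PseudoMetric E ℝ, IsContPseudo ρ ∧
      ∃ ε > 0, ∀ g : DMZ E, g ∈ mzBall ρ ε f → dist (F g) (F f) < δ) : Continuous F := by
  refine ⟨fun V hV f hf => ?_⟩
  obtain ⟨δ, hδ, hV⟩ := Metric.isOpen_iff.1 hV _ hf
  obtain ⟨ρ, hρ, ε, hε, h⟩ := h f δ hδ
  exact ⟨ρ, hρ, ε, hε, fun g hg => hV (h g hg)⟩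

theorem DJ1.continuous_of_j1Ball {E : Type u} [TopologicalSpace E] {F : DJ1 E → ℝ}
    (h : ∀ f : DJ1 E, ∀ δ > 0, ∃ ρ : PseudoMetric E ℝ, IsContPseudo ρ ∧
      ∃ ε > 0, ∀ g : DJ1 E, g ∈ j1Ball ρ ε f → dist (F g) (F f) < δ) : Continuous F := by
  refine ⟨fun V hV f hf => ?_⟩
  obtain ⟨δ, hδ, hV⟩ := Metric.isOpen_iff.1 hV _ hf
  obtain ⟨ρ, hρ, ε, hε, h⟩ := h f δ hδ
  exact ⟨ρ, hρ, ε, hε, fun g hg => hV (h g hg)⟩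

/-- Convergence in `λ`-measure of the bounded integrands suffices; the relevant pseudometric is
`|φ(x) - φ(y)|`. -/
theorem DMZ.continuous_integral {E : Type u} [TopologicalSpace E] (φ : E →ᵇ ℝ) (s t : I) :
    Continuous (fun f : DMZ E => ∫ r in Icc s t, φ (f r) ∂lam) := by
  refine DMZ.continuous_of_mzBall fun f δ hδ => ?_
  set L := lam.real univ
  have hL : 0 ≤ L := measureReal_nonneg
  -- The integrands differ by at most `ε` off a set of measure below `ε`, and by at most `2‖φ‖` on
  -- it. The total error is at most `(L + 2‖φ‖)ε`; the extra `1` makes it strictly less than `δ` and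
  -- the denominator positive.
  set ε := δ / (L + 2 * ‖φ‖ + 1)
  have hε : 0 < ε := by positivity
  refine ⟨pseudoOf φ, isContPseudo_pseudoOf φ.continuous, ε, hε, fun g hg => ?_⟩
  have hm (k : DMZ E) : Measurable fun r => φ (k r) :=
    measurable_of_right_cont (Cadlag.comp_right_cont φ k)
  have hi (k : DMZ E) : Integrable (fun r => φ (k r)) lam :=
    integrable_lam_of_right_cont (Cadlag.comp_right_cont φ k) fun r => φ.norm_coe_le_norm _
  set A : Set I := {r | ε ≤ |φ (f r) - φ (g r)|}
  have hA : MeasurableSet A := measurableSet_le measurable_const ((hm f).sub (hm g)).abs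
  have hA' : lam.real A < ε := by
    have h1 : lam A < ENNReal.ofReal ε := hg
    exact (ENNReal.toReal_lt_of_lt_ofReal h1)
  have hb (r : I) : |φ (g r) - φ (f r)| ≤ ε + A.indicator (fun _ => 2 * ‖φ‖) r := by
    by_cases hr : r ∈ A
    · rw [indicator_of_mem hr]
      have h1 := φ.norm_coe_le_norm (g r)
      have h2 := φ.norm_coe_le_norm (f r)
      have h3 := norm_sub_le (φ (g r)) (φ (f r))
      rw [Real.norm_eq_abs] at h3
      linarith
    · rw [indicator_of_notMem hr, add_zero, abs_sub_comm]
      exact (not_le.1 hr).le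
  have hint : Integrable (fun r => ε + A.indicator (fun _ => 2 * ‖φ‖) r) lam :=
    (integrable_const _).add ((integrable_const _).indicator hA)
  rw [Real.dist_eq, ← integral_sub (hi g).restrict (hi f).restrict]
  calc |∫ r in Icc s t, (φ (g r) - φ (f r)) ∂lam|
      ≤ ∫ r in Icc s t, |φ (g r) - φ (f r)| ∂lam := abs_integral_le_integral_abs
    _ ≤ ∫ r, |φ (g r) - φ (f r)| ∂lam :=
      setIntegral_le_integral ((hi g).sub (hi f)).abs (Eventually.of_forall fun _ => abs_nonneg _)
    _ ≤ ∫ r, (ε + A.indicator (fun _ => 2 * ‖φ‖) r) ∂lam :=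
      integral_mono ((hi g).sub (hi f)).abs hint hb
    _ = L * ε + lam.real A * (2 * ‖φ‖) := by
      rw [integral_add (integrable_const _) ((integrable_const _).indicator hA),
        integral_indicator_const _ hA]
      simp [L]
    _ ≤ L * ε + ε * (2 * ‖φ‖) := by gcongr
    _ < (L + 2 * ‖φ‖ + 1) * ε := by linarith
    _ = δ := by
      have : L + 2 * ‖φ‖ + 1 ≠ 0 := by positivity
      simp only [ε]; field_simp

/-- A real function with right and left limits that is right-continuous has only countably many
discontinuities. -/
theorem countable_not_continuousAt {g : I → ℝ} (hr : ∀ t, ContinuousWithinAt g (Ici t) t)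
    (hl : ∀ t, ∃ l, Tendsto g (𝓝[<] t) (𝓝 l)) : {t | ¬ ContinuousAt g t}.Countable := by
  -- At a discontinuity the left limit differs from the value, so some rational `p` lies strictly
  -- between them. For fixed `p` and fixed order, such points are isolated from the left within
  -- their set, hence countable in number.
  let A (p : ℚ) : Set I := {t | (∀ᶠ s in 𝓝[<] t, g s < p) ∧ p < g t}
  let B (p : ℚ) : Set I := {t | (∀ᶠ s in 𝓝[<] t, (p : ℝ) < g s) ∧ g t < p}
  have key (C : Set I) (hC : ∀ t ∈ C, ∀ᶠ s in 𝓝[<] t, s ∉ C) : C.Countable := by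
    refine Countable.mono (fun t ht => ?_) (countable_setOfPred_isolated_left_within (s := C))
    refine ⟨ht, ?_⟩
    rw [← empty_mem_iff_bot, inter_comm, nhdsWithin_inter']
    have h1 := hC t ht
    filter_upwards [mem_inf_of_left h1, mem_inf_of_right (mem_principal_self C)] with s h2 h3
    exact h2 h3
  have hA (p : ℚ) : (A p).Countable :=
    key _ fun t ht => ht.1.mono fun s hs hs' => lt_asymm hs hs'.2
  have hB (p : ℚ) : (B p).Countable :=
    key _ fun t ht => ht.1.mono fun s hs hs' => lt_asymm hs hs'.2
  refine ((countable_iUnion hA).union (countable_iUnion hB)).mono fun t ht => ?_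
  obtain ⟨l, h⟩ := hl t
  have hne : l ≠ g t := by
    rintro rfl
    exact ht (continuousAt_iff_continuous_left'_right'.2
      ⟨h, (hr t).mono Ioi_subset_Ici_self⟩)
  rcases lt_or_gt_of_ne hne with h' | h'
  · obtain ⟨p, hp, hp'⟩ := exists_rat_btwn h'
    exact Or.inl (mem_iUnion.2 ⟨p, h.eventually (eventually_lt_nhds hp), hp'⟩)
  · obtain ⟨p, hp, hp'⟩ := exists_rat_btwn h'
    exact Or.inr (mem_iUnion.2 ⟨p, h.eventually (eventually_gt_nhds hp'), hp⟩)

theorem ae_lam_of_countable {A : Set I} (hA : A.Countable) (h1 : (1 : I) ∉ A) :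
    ∀ᵐ t ∂lam, t ∉ A := by
  rw [ae_iff]
  simp only [not_not]
  change lam A = 0
  simp [lam, hA.measure_zero, hA.measurableSet, h1]

/-- A path is continuous outside a countable set, and there small time changes do not matter in the
limit. The endpoint `1` is the only point charged by the atom, and every time change fixes it. -/
theorem DJ1.continuous_integral {E : Type u} [TopologicalSpace E] (φ : E →ᵇ ℝ) (s t : I) :
    Continuous (fun f : DJ1 E => ∫ r in Icc s t, φ (f r) ∂lam) := by
  refine DJ1.continuous_of_j1Ball fun f δ hδ => ?_
  refine ⟨pseudoOf φ, isContPseudo_pseudoOf φ.continuous, ?_⟩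
  -- Failure for every radius `1/(n+1)` yields a sequence of paths, to which dominated convergence
  -- applies.
  by_contra! hcon
  choose g hg hgδ using fun n : ℕ => hcon (1 / ((n : ℝ) + 1)) (by positivity)
  choose γ hγ using hg
  have hm (k : DJ1 E) : Measurable fun r => φ (k r) :=
    measurable_of_right_cont (Cadlag.comp_right_cont φ k)
  have hf : Tendsto (fun n => ∫ r in Icc s t, φ (g n r) ∂lam) atTop
      (𝓝 (∫ r in Icc s t, φ (f r) ∂lam)) := by
    refine tendsto_integral_of_dominated_convergence (fun _ => ‖φ‖)
      (fun n => (hm (g n)).aestronglyMeasurable) (integrable_const _)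
      (fun n => Eventually.of_forall fun r => φ.norm_coe_le_norm _) (ae_restrict_of_ae ?_)
    have hcd := countable_not_continuousAt (Cadlag.comp_right_cont φ f) fun r => by
      obtain ⟨l, hl⟩ := f.left_lim r
      exact ⟨φ l, (φ.continuous.tendsto l).comp hl⟩
    -- The point `1` is removed from the exceptional set because `λ` charges it.
    filter_upwards [ae_lam_of_countable (hcd.mono (sdiff_subset (t := {1}))) (by simp)] with r hr
    have h0 := tendsto_one_div_add_atTop_nhds_zero_nat (𝕜 := ℝ)
    have h1 : Tendsto (fun n => φ (f (γ n r))) atTop (𝓝 (φ (f r))) := by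
      by_cases hr1 : r = 1
      · subst hr1
        have : ∀ n, γ n 1 = 1 := fun n => (γ n).map_top
        simp [this]
      · have hc : ContinuousAt (fun r => φ (f r)) r := by
          by_contra hc
          exact hr ⟨hc, hr1⟩
        refine hc.tendsto.comp (tendsto_iff_dist_tendsto_zero.2 ?_)
        refine squeeze_zero (fun _ => dist_nonneg) (fun n => ?_) h0
        exact (hγ n r).1.le
    have h2 : Tendsto (fun n => φ (f (γ n r)) - φ (g n r)) atTop (𝓝 0) :=
      squeeze_zero_norm (fun n => (hγ n r).2.le) h0
    simpa using h1.sub h2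
  obtain ⟨N, hN⟩ := Metric.tendsto_atTop.1 hf δ hδ
  exact absurd (hN N le_rfl) (not_lt.2 (hgδ N))

theorem continuous_integral_continuousMap {S : Type u} [TopologicalSpace S] (φ : S →ᵇ ℝ)
    (s t : I) : Continuous (fun f : C(I, S) => ∫ r in Icc s t, φ (f r) ∂lam) := by
  have h1 : Continuous fun f : C(I, S) => φ.toContinuousMap.comp f :=
    ContinuousMap.continuous_postcomp _
  have h2 : LipschitzWith (lam.real (Icc s t)).toNNReal
      (fun g : C(I, ℝ) => ∫ r in Icc s t, g r ∂lam) := by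
    refine LipschitzWith.of_dist_le_mul fun g k => ?_
    have hi (g : C(I, ℝ)) : Integrable g (lam.restrict (Icc s t)) :=
      Integrable.of_bound g.continuous.measurable.aestronglyMeasurable ‖g‖
        (Eventually.of_forall g.norm_coe_le_norm)
    rw [Real.dist_eq, ← integral_sub (hi g) (hi k), Real.coe_toNNReal _ measureReal_nonneg,
      mul_comm]
    exact norm_setIntegral_le_of_norm_le_const (f := fun r => g r - k r) (measure_lt_top _ _)
      fun r _ => ContinuousMap.dist_apply_le_dist (f := g) (g := k) r
  exact h2.continuous.comp h1


/-! ### Measurability on complete filtered spaces -/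

theorem FiltSpace.measurableSet_of_null (B : FiltSpace.{v}) (t : I) {A : Set B.Ω}
    (hA : B.P A = 0) : MeasurableSet[B.𝓕 t] A :=
  B.𝓕.mono (show (0 : I) ≤ t from t.2.1) A (B.complete A hA)

/-- An event whose conditional probability is zero or one belongs to the conditioning
`σ`-algebra, up to null sets. -/
theorem FiltSpace.measurableSet_of_condExp (B : FiltSpace.{v}) (t : I) {A : Set B.Ω}
    (hA : MeasurableSet A)
    (h : ∀ᵐ ω ∂B.P, (B.P[A.indicator (fun _ => (1 : ℝ)) | B.𝓕 t]) ω = 0 ∨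
      (B.P[A.indicator (fun _ => (1 : ℝ)) | B.𝓕 t]) ω = 1) : MeasurableSet[B.𝓕 t] A := by
  set p := B.P[A.indicator (fun _ => (1 : ℝ)) | B.𝓕 t]
  have hp : Measurable[B.𝓕 t] p := stronglyMeasurable_condExp.measurable
  set D : Set B.Ω := p ⁻¹' {1}
  have hD : MeasurableSet[B.𝓕 t] D := hp (measurableSet_singleton 1)
  have hD' : MeasurableSet D := B.𝓕.le t D hD
  have hi : Integrable (A.indicator (fun _ => (1 : ℝ))) B.P :=
    (integrable_const _).indicator hA
  have key {C : Set B.Ω} (hC : MeasurableSet[B.𝓕 t] C) :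
      ∫ ω in C, p ω ∂B.P = B.P.real (A ∩ C) := by
    rw [setIntegral_condExp (B.𝓕.le t) hi hC, integral_indicator_const _ hA]
    simp [measureReal_restrict_apply hA]
  have h1 : B.P.real (A ∩ D) = B.P.real D := by
    rw [← key hD, setIntegral_congr_fun hD' (g := fun _ => (1 : ℝ)) fun ω hω => hω]
    simp
  have h2 : B.P.real (A ∩ Dᶜ) = 0 := by
    rw [← key hD.compl]
    refine integral_eq_zero_of_ae ?_
    filter_upwards [ae_restrict_of_ae h, ae_restrict_mem hD'.compl] with ω h3 h4
    exact h3.resolve_right h4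
  have h3 : B.P (D \ A) = 0 := by
    rw [← measureReal_eq_zero_iff]
    have := measureReal_inter_add_sdiff (μ := B.P) (s := D) hA
    rw [inter_comm] at this
    linarith
  have h4 : B.P (A ∩ Dᶜ) = 0 := (measureReal_eq_zero_iff).1 h2
  -- Thus `A` differs from the `𝓕ₜ`-event `D = {p = 1}` by null sets, which belong to `𝓕ₜ` by
  -- completeness.
  have h5 : A = (D \ (D \ A)) ∪ (A ∩ Dᶜ) := by
    ext ω; simp only [mem_union, Set.mem_sdiff, mem_inter_iff, mem_compl_iff]; tauto
  rw [h5]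
  exact (hD.diff (B.measurableSet_of_null t h3)).union (B.measurableSet_of_null t h4)

theorem RV.measurable_comp {B : FiltSpace.{v}} {E : Type u} [TopologicalSpace E] (X : RV B E)
    (F : E →ᵇ ℝ) : Measurable[B.𝓕 1] (fun ω => F (X ω)) := by
  let _ : MeasurableSpace E := borel E
  have _ : BorelSpace E := ⟨rfl⟩
  exact F.continuous.measurable.comp X.meas

theorem RV.measurable_comp' {B : FiltSpace.{v}} {E : Type u} [TopologicalSpace E] (X : RV B E)
    (F : E →ᵇ ℝ) : Measurable (fun ω => F (X ω)) :=
  (X.measurable_comp F).mono (B.𝓕.le 1) le_rfl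

theorem RV.integral_law {B : FiltSpace.{v}} {E : Type u} [TopologicalSpace E] (X : RV B E)
    (F : E →ᵇ ℝ) : PM.integral F X.law = ∫ ω, F (X ω) ∂B.P := by
  let _ : MeasurableSpace E := borel E
  have _ : BorelSpace E := ⟨rfl⟩
  change ∫ x, F x ∂(B.P.map X) = _
  exact integral_map (X.meas.mono (B.𝓕.le 1) le_rfl).aemeasurable
    F.continuous.measurable.aestronglyMeasurable

theorem measurableSet_borel_preimage {E : Type u} [TopologicalSpace E] (F : E →ᵇ ℝ)
    {A : Set ℝ} (hA : MeasurableSet A) : MeasurableSet[borel E] (F ⁻¹' A) := by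
  let _ : MeasurableSpace E := borel E
  have _ : BorelSpace E := ⟨rfl⟩
  exact F.continuous.measurable hA

/-! ### Conditional variances of prediction processes -/

/-- If `F(X)` is `𝓕ᵣ`-measurable, then it is deterministic under the prediction at time `r`. -/
theorem IsPrediction.ae_eq {B : FiltSpace.{v}} {E : Type u} [TopologicalSpace E] {X : RV B E}
    {Z : RV B (Next E)} (hZ : IsPrediction X Z) {F : E →ᵇ ℝ} {r : I}
    (hF : Measurable[B.𝓕 r] (fun ω => F (X ω))) :
    ∀ᵐ ω ∂B.P, ∀ᵐ x ∂((Z ω).1 r).toMeasure, F x = F (X ω) := by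
  -- The event `{F(X) ≤ q}` lies in `𝓕ᵣ`, so its conditional probability is its own indicator.
  -- Rational `q` allow a common null set and still determine `F`.
  have h1 (q : ℚ) : ∀ᵐ ω ∂B.P, ((Z ω).1 r).toMeasure.real (F ⁻¹' Iic (q : ℝ)) =
      ((X ⁻¹' (F ⁻¹' Iic (q : ℝ))).indicator (fun _ => (1 : ℝ))) ω := by
    have hA : MeasurableSet[B.𝓕 r] (X ⁻¹' (F ⁻¹' Iic (q : ℝ))) := hF measurableSet_Iic
    filter_upwards [(hZ r).2 _ (measurableSet_borel_preimage F measurableSet_Iic)] with ω hω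
    rw [hω, condExp_of_stronglyMeasurable (B.𝓕.le r)
      (stronglyMeasurable_const.indicator hA)
      ((integrable_const _).indicator (B.𝓕.le r _ hA))]
  filter_upwards [ae_all_iff.2 h1] with ω hω
  have h2 : ∀ᵐ x ∂((Z ω).1 r).toMeasure, ∀ q : ℚ, (F x ≤ q ↔ F (X ω) ≤ q) := by
    refine ae_all_iff.2 fun q => ?_
    have h3 := hω q
    have hm := measurableSet_borel_preimage F (measurableSet_Iic (a := (q : ℝ)))
    by_cases hq : F (X ω) ≤ q
    · rw [indicator_of_mem (show ω ∈ X ⁻¹' (F ⁻¹' Iic (q : ℝ)) from hq)] at h3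
      have h4 : ((Z ω).1 r).toMeasure (F ⁻¹' Iic (q : ℝ)) = 1 := by
        rw [← ENNReal.toReal_eq_one_iff]; exact h3
      rw [← prob_compl_eq_zero_iff hm] at h4
      filter_upwards [compl_mem_ae_iff.2 h4] with x hx
      exact ⟨fun _ => hq, fun _ => not_not.1 hx⟩
    · rw [indicator_of_notMem (show ω ∉ X ⁻¹' (F ⁻¹' Iic (q : ℝ)) from hq),
        measureReal_eq_zero_iff] at h3
      filter_upwards [compl_mem_ae_iff.2 h3] with x hx
      exact ⟨fun h => absurd h hx, fun h => absurd h hq⟩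
  filter_upwards [h2] with x hx
  refine le_antisymm (le_of_forall_rat_lt_imp_le ?_) (le_of_forall_rat_lt_imp_le ?_)
  · intro q hq
    by_contra h
    exact absurd ((hx q).2 (not_le.1 h).le) (not_le.2 hq)
  · intro q hq
    by_contra h
    exact absurd ((hx q).1 (not_le.1 h).le) (not_le.2 hq)

/-- If the conditional variance of `F(X)` given `𝓕ₜ` vanishes, then `F(X)` is
`𝓕ₜ`-measurable. -/
theorem IsPrediction.measurable_of_variance {B : FiltSpace.{v}} {E : Type u} [TopologicalSpace E]
    {X : RV B E} {Z : RV B (Next E)} (hZ : IsPrediction X Z) {F : E →ᵇ ℝ} {t : I}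
    (h : ∀ᵐ ω ∂B.P, PM.variance F ((Z ω).1 t) = 0) :
    Measurable[B.𝓕 t] (fun ω => F (X ω)) := by
  refine @measurable_of_Iic ℝ B.Ω _ _ _ (B.𝓕 t) _ _ _ _ fun q => ?_
  refine B.measurableSet_of_condExp t (X.measurable_comp' F measurableSet_Iic) ?_
  have hm := measurableSet_borel_preimage F (measurableSet_Iic (a := q))
  filter_upwards [h, (hZ t).2 _ hm] with ω h1 h2
  obtain ⟨c, hc⟩ := (PM.variance_eq_zero_iff _ _).1 h1
  change (B.P[(X ⁻¹' (F ⁻¹' Iic q)).indicator (fun _ => (1 : ℝ)) | B.𝓕 t]) ω = 0 ∨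
    (B.P[(X ⁻¹' (F ⁻¹' Iic q)).indicator (fun _ => (1 : ℝ)) | B.𝓕 t]) ω = 1
  rw [← h2]
  by_cases hq : c ≤ q
  · right
    have h4 : ((Z ω).1 t).toMeasure (F ⁻¹' Iic q) = 1 := by
      rw [← prob_compl_eq_zero_iff hm]
      exact measure_mono_null (fun x (hx : ¬ F x ≤ q) (hxc : F x = c) => hx (hxc ▸ hq)) hc
    simp [Measure.real, h4]
  · left
    rw [measureReal_eq_zero_iff]
    exact measure_mono_null (fun x (hx : F x ≤ q) (hxc : F x = c) => hq (hxc ▸ hx)) hc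

/-- The variances of `F` along the measure-valued path `z`, integrated over `[t,1]`. -/
noncomputable def Next.variance {E : Type u} [TopologicalSpace E] (F : E →ᵇ ℝ) (t : I) :
    Next E →ᵇ ℝ :=
  .ofNormedAddCommGroup (fun z => ∫ r in Icc t 1, PM.variance F (z.1 r) ∂lam)
    ((DMZ.continuous_integral (PM.variance F) t 1).comp continuous_subtype_val)
    (‖PM.variance F‖ * lam.real (Icc t 1)) fun z =>
      norm_setIntegral_le_of_norm_le_const (measure_lt_top _ _)
        fun r _ => (PM.variance F).norm_coe_le_norm (z.1 r)

theorem Next.variance_apply {E : Type u} [TopologicalSpace E] (F : E →ᵇ ℝ) (t : I) (z : Next E) :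
    Next.variance F t z = ∫ r in Icc t 1, PM.variance F (z.1 r) ∂lam := rfl

theorem Next.variance_nonneg {E : Type u} [TopologicalSpace E] (F : E →ᵇ ℝ) (t : I) (z : Next E) :
    0 ≤ Next.variance F t z :=
  integral_nonneg fun _ => PM.variance_nonneg _ _

theorem exists_countable_dense_mem (t : I) :
    ∃ D : Set I, D.Countable ∧ Dense D ∧ (1 : I) ∈ D ∧ t ∈ D := by
  obtain ⟨D, hD, hD'⟩ := TopologicalSpace.exists_countable_dense I
  exact ⟨insert 1 (insert t D), (hD.insert t).insert 1,
    hD'.mono ((subset_insert _ _).trans (subset_insert _ _)), by simp, by simp⟩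

theorem IsPrediction.integral_variance_eq_zero {B : FiltSpace.{v}} {E : Type u}
    [TopologicalSpace E] {X : RV B E} {Z : RV B (Next E)} (hZ : IsPrediction X Z) {F : E →ᵇ ℝ}
    {t : I} (hF : Measurable[B.𝓕 t] (fun ω => F (X ω))) :
    PM.integral (Next.variance F t) Z.law = 0 := by
  rw [RV.integral_law]
  refine integral_eq_zero_of_ae ?_
  obtain ⟨D, hD, hD', hD1, htD⟩ := exists_countable_dense_mem t
  -- For each fixed time the variance vanishes only almost surely; a countable dense set of times
  -- gives one null set, and right-continuity covers the other times.
  have h1 : ∀ᵐ ω ∂B.P, ∀ r ∈ D, t ≤ r → PM.variance F ((Z ω).1 r) = 0 := by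
    refine (ae_ball_iff hD).2 fun r _ => ?_
    by_cases htr : t ≤ r
    · filter_upwards [hZ.ae_eq (hF.mono (B.𝓕.mono htr) le_rfl)] with ω hω _
      exact (PM.variance_eq_zero_iff _ _).2 ⟨_, hω⟩
    · exact Eventually.of_forall fun ω h => absurd h htr
  filter_upwards [h1] with ω hω
  rw [Next.variance_apply]
  refine setIntegral_eq_zero_of_forall_eq_zero fun r hr => ?_
  -- Freezing the path before time `t` gives a right-continuous function on all of `[0,1]`; since `t
  -- ∈ D`, the time `max t s` stays in `D` for `s ∈ D`.
  have h2 : ∀ s, ContinuousWithinAt (fun s => PM.variance F ((Z ω).1 (max t s))) (Ici s) s :=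
    fun s => ContinuousWithinAt.comp (t := Ici (max t s)) (f := fun s => max t s)
      (g := fun s => PM.variance F ((Z ω).1 s)) (Cadlag.comp_right_cont _ _ _)
      (by fun_prop) fun a (ha : s ≤ a) => max_le_max_left t ha
  have h3 := eq_of_right_cont h2 hD' hD1 (c := 0) (fun s hs => hω _ ?_ (le_max_left t s)) r
  · rwa [max_eq_right hr.1] at h3
  · rcases max_choice t s with h | h <;> rwa [h]

theorem ae_variance_eq_zero_of_integral {B : FiltSpace.{v}} {E : Type u}
    [TopologicalSpace E] {Z : RV B (Next E)} {F : E →ᵇ ℝ} {t : I}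
    (h : PM.integral (Next.variance F t) Z.law = 0) :
    ∀ᵐ ω ∂B.P, PM.variance F ((Z ω).1 t) = 0 := by
  rw [RV.integral_law] at h
  have hi : Integrable (fun ω => Next.variance F t (Z ω)) B.P :=
    Integrable.of_bound (Z.measurable_comp' _).aestronglyMeasurable ‖Next.variance F t‖
      (Eventually.of_forall fun ω => (Next.variance F t).norm_coe_le_norm _)
  rw [integral_eq_zero_iff_of_nonneg (fun ω => Next.variance_nonneg _ _ _) hi] at h
  filter_upwards [h] with ω hω
  exact eq_zero_of_integral_eq_zero (Cadlag.comp_right_cont (PM.variance F) (Z ω).1)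
    (fun r => (PM.variance F).norm_coe_le_norm _) (fun r => PM.variance_nonneg _ _) hω


/-! ### Path spaces and adaptedness -/

/-- A topological space of right-continuous paths, with `ev x t` the value of the path `x` at
time `t`, on which the time integrals of bounded continuous functions are continuous. -/
structure IsPathSpace {E S : Type u} [TopologicalSpace E] [TopologicalSpace S]
    (ev : E → I → S) : Prop where
  right_cont : ∀ x t, ContinuousWithinAt (ev x) (Ici t) t
  injective : Function.Injective ev
  continuous_integral : ∀ (φ : S →ᵇ ℝ) (s t : I),
    Continuous fun x => ∫ r in Icc s t, φ (ev x r) ∂lam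

/-- The time integral `∫ₛᵗ φ(xᵣ) λ(dr)` as a function of the path `x`. -/
noncomputable def IsPathSpace.timeIntegral {E S : Type u} [TopologicalSpace E]
    [TopologicalSpace S] {ev : E → I → S} (h : IsPathSpace ev) (φ : S →ᵇ ℝ) (s t : I) : E →ᵇ ℝ :=
  .ofNormedAddCommGroup (fun x => ∫ r in Icc s t, φ (ev x r) ∂lam) (h.continuous_integral φ s t)
    (‖φ‖ * lam.real (Icc s t)) fun x =>
      norm_setIntegral_le_of_norm_le_const (measure_lt_top _ _)
        fun r _ => φ.norm_coe_le_norm (ev x r)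

section PathSpace

variable {E S : Type u} [TopologicalSpace E] [TopologicalSpace S] {ev : E → I → S}

theorem IsPathSpace.comp_right_cont (h : IsPathSpace ev) (φ : S →ᵇ ℝ) (x : E) (t : I) :
    ContinuousWithinAt (fun s => φ (ev x s)) (Ici t) t :=
  φ.continuous.continuousAt.comp_continuousWithinAt (h.right_cont x t)

/-- The value of a path is the limit of its time averages. -/
theorem IsPathSpace.tendsto_timeIntegral (h : IsPathSpace ev) (φ : S →ᵇ ℝ) (x : E) (t : I) :
    Tendsto (fun n => (lam.real (Icc t (gridRight n t)))⁻¹ *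
      h.timeIntegral φ t (gridRight n t) x) atTop (𝓝 (φ (ev x t))) :=
  tendsto_average_of_right_cont (h.comp_right_cont φ x) (fun _ => φ.norm_coe_le_norm _) t

theorem measurable_integral_of_right_cont {Ω : Type*} [MeasurableSpace Ω] {g : I → Ω → ℝ}
    (hr : ∀ ω t, ContinuousWithinAt (fun s => g s ω) (Ici t) t) (hm : ∀ t, Measurable (g t))
    (s t : I) : Measurable fun ω => ∫ r in Icc s t, g r ω ∂lam :=
  (StronglyMeasurable.integral_prod_left' (μ := lam.restrict (Icc s t))
    (measurable_uncurry_of_right_cont hr hm).stronglyMeasurable).measurable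

/-- Time integrals up to time `t` of an adapted process are `𝓕ₜ`-measurable. -/
theorem IsPathSpace.measurable_timeIntegral (h : IsPathSpace ev) {X : FRV.{u, v} E}
    (hX : X.IsAdapted ev) (φ : S →ᵇ ℝ) (s t : I) :
    Measurable[X.base.𝓕 t] (fun ω => h.timeIntegral φ s t (X.X ω)) := by
  -- Stopping the path at `t` does not change the integral over `[s, t]` and makes the integrand
  -- `𝓕ₜ`-measurable at every time.
  have h1 : (fun ω => h.timeIntegral φ s t (X.X ω)) =
      fun ω => ∫ r in Icc s t, φ (ev (X.X ω) (min t r)) ∂lam := by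
    funext ω
    refine setIntegral_congr_fun measurableSet_Icc fun r hr => ?_
    simp only [min_eq_right hr.2]
  rw [h1]
  let _ : MeasurableSpace S := borel S
  have _ : BorelSpace S := ⟨rfl⟩
  refine @measurable_integral_of_right_cont _ (X.base.𝓕 t) _ (fun ω r => ?_) (fun r => ?_) s t
  · exact ContinuousWithinAt.comp (t := Ici (min t r)) (f := fun s => min t s)
      (g := fun s => φ (ev (X.X ω) s)) (h.comp_right_cont _ _ _)
      (by fun_prop) fun a (ha : r ≤ a) => min_le_min_left t ha
  · exact φ.continuous.measurable.comp
      ((hX (min t r)).mono (X.base.𝓕.mono (min_le_left _ _)) le_rfl)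

/-- Real-valued bounded continuous functions detect Borel measurability of maps into metrizable
spaces. -/
theorem measurable_borel_of_comp [TopologicalSpace.MetrizableSpace S] {Ω : Type*}
    [MeasurableSpace Ω] {f : Ω → S} (h : ∀ φ : S →ᵇ ℝ, Measurable fun ω => φ (f ω)) :
    @Measurable Ω S _ (borel S) f := by
  let _ := TopologicalSpace.metrizableSpaceMetric S
  let _ : MeasurableSpace S := borel S
  have _ : BorelSpace S := ⟨rfl⟩
  refine measurable_of_isClosed fun C hC => ?_
  rcases C.eq_empty_or_nonempty with rfl | hne
  · simp
  let φ : S →ᵇ ℝ := .ofNormedAddCommGroup (fun x => min 1 (Metric.infDist x C))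
    (continuous_const.min (Metric.continuous_infDist_pt C)) 1 fun x => by
      rw [Real.norm_eq_abs, abs_of_nonneg (le_min zero_le_one Metric.infDist_nonneg)]
      exact min_le_left _ _
  have h1 : f ⁻¹' C = (fun ω => φ (f ω)) ⁻¹' {0} := by
    ext ω
    change f ω ∈ C ↔ min 1 (Metric.infDist (f ω) C) = 0
    rw [hC.mem_iff_infDist_zero hne]
    constructor
    · intro h; simp [h]
    · intro h
      rcases min_choice 1 (Metric.infDist (f ω) C) with h' | h'
      · rw [h'] at h; exact absurd h one_ne_zero
      · rwa [← h']
  rw [h1]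
  exact h φ (measurableSet_singleton 0)

theorem FiltSpace.measurable_of_forall_gt {B : FiltSpace.{v}} {t : I} (ht : t < 1)
    {f : B.Ω → ℝ} (h : ∀ u > t, Measurable[B.𝓕 u] f) : Measurable[B.𝓕 t] f := by
  intro A hA
  refine B.right_cont.RC t _ ?_
  rw [B.𝓕.rightCont_eq_of_not_isMax (not_isMax_iff.2 ⟨1, ht⟩)]
  simp only [MeasurableSpace.measurableSet_iInf]
  exact fun u hu => h u hu hA

/-- A process is adapted as soon as its time integrals up to time `t` are `𝓕ₜ`-measurable. -/
theorem IsPathSpace.isAdapted_of_timeIntegral [TopologicalSpace.MetrizableSpace S]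
    (h : IsPathSpace ev) {X : FRV.{u, v} E}
    (hX : ∀ (φ : S →ᵇ ℝ) (s t : I), s ≤ t →
      Measurable[X.base.𝓕 t] (fun ω => h.timeIntegral φ s t (X.X ω))) :
    X.IsAdapted ev := by
  intro t
  refine @measurable_borel_of_comp _ _ _ _ (X.base.𝓕 t) _ fun φ => ?_
  -- The averaging intervals eventually end before `u`, so the limit is `𝓕ᵤ`-measurable. For `t = 1`
  -- one takes `u = 1`; otherwise `u` decreases to `t`.
  have key {u : I} (hu : ∀ᶠ n in atTop, gridRight n t ≤ u) :
      Measurable[X.base.𝓕 u] (fun ω => φ (ev (X.X ω) t)) := by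
    obtain ⟨N, hN⟩ := eventually_atTop.1 hu
    refine @measurable_of_tendsto_metrizable _ _ (X.base.𝓕 u) _ _ _ _
      (fun n ω => (lam.real (Icc t (gridRight (n + N) t)))⁻¹ *
        h.timeIntegral φ t (gridRight (n + N) t) (X.X ω)) _ (fun n => ?_)
      (tendsto_pi_nhds.2 fun ω =>
        (tendsto_add_atTop_iff_nat N).2 (h.tendsto_timeIntegral φ (X.X ω) t))
    exact ((hX φ t _ (le_gridRight _ _)).const_mul _).mono
      (X.base.𝓕.mono (hN _ (Nat.le_add_left _ _))) le_rfl
  rcases eq_or_lt_of_le (show t ≤ 1 from t.2.2) with rfl | ht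
  · exact key (Eventually.of_forall fun n => (gridRight_one n).le)
  · refine FiltSpace.measurable_of_forall_gt ht fun u hu => key ?_
    filter_upwards [(tendsto_nhds_of_tendsto_nhdsWithin (tendsto_gridRight t)).eventually
      (eventually_lt_nhds hu)] with n hn using hn.le

/-- Bounded continuous functions separating the points of a separable metrizable space. -/
theorem exists_separating_seq (S : Type u) [TopologicalSpace S]
    [TopologicalSpace.MetrizableSpace S] [SecondCountableTopology S] :
    ∃ φ : ℕ → S →ᵇ ℝ, ∀ x y, (∀ k, φ k x = φ k y) → x = y := by
  let _ := TopologicalSpace.metrizableSpaceMetric S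
  rcases isEmpty_or_nonempty S with hS | hS
  · exact ⟨fun _ => 0, fun x => hS.elim x⟩
  let d := TopologicalSpace.denseSeq S
  refine ⟨fun k => .ofNormedAddCommGroup (fun x => min 1 (dist x (d k))) (by fun_prop) 1
    fun x => ?_, fun x y hxy => ?_⟩
  · rw [Real.norm_eq_abs, abs_of_nonneg (le_min zero_le_one dist_nonneg)]
    exact min_le_left _ _
  · by_contra hne
    have hpos : 0 < dist x y := dist_pos.2 hne
    obtain ⟨k, hk⟩ := (TopologicalSpace.denseRange_denseSeq S).exists_dist_lt x
      (show 0 < min 1 (dist x y / 2) by positivity)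
    have h1 : min 1 (dist x (d k)) = min 1 (dist y (d k)) := hxy k
    have h2 : dist x (d k) < 1 := hk.trans_le (min_le_left _ _)
    have h3 : dist x (d k) < dist x y / 2 := hk.trans_le (min_le_right _ _)
    rw [min_eq_right h2.le] at h1
    have h4 : dist y (d k) = dist x (d k) := by
      rcases min_choice 1 (dist y (d k)) with h' | h'
      · rw [h'] at h1; exact absurd h1 h2.ne
      · rw [h1, h']
    have h5 := dist_triangle_right x y (d k)
    linarith

/-- Time integrals over grid intervals starting in a countable dense set determine the path at those
times, hence everywhere by right-continuity. Countability permits a common null set in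
`IsPrediction.ae_eq_dirac`. -/
theorem IsPathSpace.exists_separating [TopologicalSpace.MetrizableSpace S]
    [SecondCountableTopology S] (h : IsPathSpace ev) :
    ∃ (ι : Type) (_ : Countable ι) (F : ι → E →ᵇ ℝ),
      ∀ x y, (∀ k, F k x = F k y) → x = y := by
  obtain ⟨φ, hφ⟩ := exists_separating_seq S
  obtain ⟨D, hD, hD', hD1, -⟩ := exists_countable_dense_mem 1
  have := hD.to_subtype
  refine ⟨ℕ × D × ℕ, inferInstance,
    fun k => h.timeIntegral (φ k.1) k.2.1 (gridRight k.2.2 k.2.1), fun x y hxy => ?_⟩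
  refine h.injective (funext fun t => hφ _ _ fun k => ?_)
  have h1 := eq_of_right_cont (g := fun t => φ k (ev x t) - φ k (ev y t))
    (fun t => (h.comp_right_cont (φ k) x t).sub (h.comp_right_cont (φ k) y t)) hD' hD1 (c := 0)
    (fun t ht => ?_) t
  · linarith
  · rw [sub_eq_zero]
    refine tendsto_nhds_unique (h.tendsto_timeIntegral (φ k) x t) ?_
    refine (h.tendsto_timeIntegral (φ k) y t).congr fun n => ?_
    rw [hxy (k, ⟨t, ht⟩, n)]

end PathSpace


/-! ### Deterministic random variables -/

/-- A deterministic random variable. -/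
def RV.const (B : FiltSpace.{v}) {E : Type u} [TopologicalSpace E] (x : E) : RV B E where
  toFun := fun _ => x
  meas := @measurable_const _ _ (borel E) (B.𝓕 1) _

/-- The measure-valued path that is constantly equal to the Dirac measure at `x`. -/
noncomputable def Next.dirac {E : Type u} [TopologicalSpace E] (x : E) : Next E :=
  ⟨(Cadlag.const (PM.dirac x) : Cadlag (PM E)), ⟨_, rfl⟩⟩

theorem isPrediction_const (B : FiltSpace.{v}) {E : Type u} [TopologicalSpace E] (x : E) :
    IsPrediction (RV.const B x) (RV.const B (Next.dirac x)) := by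
  refine fun t => ⟨@measurable_const _ _ (borel (PM E)) (B.𝓕 t) _, fun A hA => ?_⟩
  have h1 : (((RV.const B x) ⁻¹' A).indicator (fun _ => (1 : ℝ))) =
      fun _ => A.indicator (fun _ => (1 : ℝ)) x := rfl
  rw [h1, condExp_const (B.𝓕.le t)]
  refine Eventually.of_forall fun ω => ?_
  let _ : MeasurableSpace E := borel E
  change (Measure.dirac x).real A = A.indicator (fun _ => (1 : ℝ)) x
  rw [Measure.real, Measure.dirac_apply' _ hA]
  by_cases hx : x ∈ A <;> simp [hx]

theorem Cadlag.toFun_injective {E : Type u} [TopologicalSpace E] :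
    Function.Injective (Cadlag.toFun : Cadlag E → I → E) := by
  rintro ⟨_, _, _⟩ ⟨_, _, _⟩ rfl
  rfl

/-- The prediction process of a deterministic random variable is unique. -/
theorem IsPrediction.ae_eq_dirac {B : FiltSpace.{v}} {E : Type u} [TopologicalSpace E] {ι : Type}
    [Countable ι] {F : ι → E →ᵇ ℝ} (hF : ∀ x y, (∀ k, F k x = F k y) → x = y) {x : E}
    {Z : RV B (Next E)} (hZ : IsPrediction (RV.const B x) Z) :
    ∀ᵐ ω ∂B.P, Z ω = Next.dirac x := by
  obtain ⟨D, hD, hD', hD1, -⟩ := exists_countable_dense_mem 1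
  have h1 : ∀ᵐ ω ∂B.P, ∀ r ∈ D, ∀ k, ∀ᵐ y ∂((Z ω).1 r).toMeasure, F k y = F k x :=
    (ae_ball_iff hD).2 fun r _ => ae_all_iff.2 fun k => hZ.ae_eq (F := F k)
      (@measurable_const _ _ _ (B.𝓕 r) (F k x))
  filter_upwards [h1] with ω hω
  have h2 (r : I) (k : ι) : ∀ᵐ y ∂((Z ω).1 r).toMeasure, F k y = F k x := by
    -- Both the variance and the mean of `F k` are right-continuous along the path; together they
    -- force `F k = F k x` almost surely at every time.
    have hv : PM.variance (F k) ((Z ω).1 r) = 0 :=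
      eq_of_right_cont (Cadlag.comp_right_cont (PM.variance (F k)) (Z ω).1) hD' hD1
        (fun s hs => (PM.variance_eq_zero_iff _ _).2 ⟨_, hω s hs k⟩) r
    have hi : PM.integral (F k) ((Z ω).1 r) = F k x := by
      refine eq_of_right_cont (Cadlag.comp_right_cont (PM.integral (F k)) (Z ω).1) hD' hD1
        (fun s hs => ?_) r
      rw [PM.integral_apply, integral_congr_ae (hω s hs k)]
      simp
    obtain ⟨c, hc⟩ := (PM.variance_eq_zero_iff _ _).1 hv
    have hcx : c = F k x := by
      rw [← hi, PM.integral_apply, integral_congr_ae hc]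
      simp
    rwa [hcx] at hc
  have h3 (r : I) : (Z ω).1 r = PM.dirac x :=
    PM.ext_of_ae_eq ((ae_all_iff.2 (h2 r)).mono fun y hy => hF y x hy)
  exact Subtype.ext (Cadlag.toFun_injective (funext h3))

/-! ### The chosen version `RV.pp` and its default value -/

theorem RV.isPrediction_pp {B : FiltSpace.{v}} {E : Type u} [TopologicalSpace E] {X : RV B E}
    (h : ∃ Z : RV B (Next E), IsPrediction X Z) : IsPrediction X X.pp := by
  unfold RV.pp
  rw [dif_pos h]
  exact h.choose_spec

/-- Almost surely equal random variables have the same prediction process. -/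
theorem RV.pp_congr {B : FiltSpace.{v}} {E : Type u} [TopologicalSpace E] {X Y : RV B E}
    (hXY : ∀ᵐ ω ∂B.P, X ω = Y ω) (h : ∃ Z : RV B (Next E), IsPrediction X Z) :
    X.pp = Y.pp := by
  -- The choice in `RV.pp` depends only on this predicate, so the chosen versions agree everywhere
  -- and not just almost surely.
  have h1 : IsPrediction X = IsPrediction Y := by
    funext Z
    refine propext (forall_congr' fun t => and_congr_right fun _ =>
      forall_congr' fun A => forall_congr' fun _ => ?_)
    have h2 : (X ⁻¹' A).indicator (fun _ => (1 : ℝ)) =ᵐ[B.P]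
        (Y ⁻¹' A).indicator (fun _ => (1 : ℝ)) := by
      filter_upwards [hXY] with ω hω
      change A.indicator (fun _ => (1 : ℝ)) (X ω) = A.indicator (fun _ => (1 : ℝ)) (Y ω)
      rw [hω]
    have h3 := condExp_congr_ae (m := B.𝓕 t) h2
    exact ⟨fun h => h.trans h3, fun h => h.trans h3.symm⟩
  have h' : ∃ Z : RV B (Next E), IsPrediction Y Z := h1 ▸ h
  unfold RV.pp
  rw [dif_pos h, dif_pos h']
  congr

theorem RV.pp_eq_const {B : FiltSpace.{v}} {E : Type u} [TopologicalSpace E] {X : RV B E}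
    (h : ¬ ∃ Z : RV B (Next E), IsPrediction X Z) :
    ∃ x : E, X.pp = RV.const B (Next.dirac x) := by
  refine ⟨X B.nonempty.some, ?_⟩
  unfold RV.pp
  rw [dif_neg h]
  rfl

/-- If the first prediction process of `X` is the one of a deterministic random variable, then
`X` is equivalent to that random variable. -/
theorem FRV.equiv_const {E : Type u} [TopologicalSpace E] {ι : Type} [Countable ι]
    {F : ι → E →ᵇ ℝ} (hF : ∀ x y, (∀ k, F k x = F k y) → x = y) {X : FRV.{u, v} E} {x : E}
    (hX : X.X.pp = RV.const X.base (Next.dirac x)) :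
    X.Equiv ⟨X.base, RV.const X.base x⟩ := by
  set B := X.base
  set Y : RV B E := RV.const B x
  have h0 : ∀ᵐ ω ∂B.P, X.X.ppIter 1 ω = Y.ppIter 1 ω := by
    filter_upwards [(RV.isPrediction_pp ⟨_, isPrediction_const B x⟩).ae_eq_dirac hF] with ω hω
    change X.X.pp ω = Y.pp ω
    rw [hω, hX]
    rfl
  -- At rank one the processes agree only almost surely; from rank two on they are literally equal.
  have h1 (n : ℕ) : X.X.ppIter (n + 2) = Y.ppIter (n + 2) := by
    induction n with
    | zero =>
      refine RV.pp_congr h0 ?_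
      change ∃ Z : RV B (Next (Next E)), IsPrediction X.X.pp Z
      rw [hX]
      exact ⟨_, isPrediction_const B _⟩
    | succ n ih =>
      change (X.X.ppIter (n + 2)).pp = (Y.ppIter (n + 2)).pp
      rw [ih]
  have h2 : ∀ᵐ ω ∂B.P, X.X.ppInf ω = Y.ppInf ω := by
    filter_upwards [h0] with ω hω
    have h3 (n : ℕ) : X.X.ppPath n ω = Y.ppPath n ω := by
      cases n with
      | zero => exact hω
      | succ n =>
        change X.X.ppIter (n + 2) ω = Y.ppIter (n + 2) ω
        rw [h1]
    exact Subtype.ext (Cadlag.toFun_injective (funext fun t => funext fun n =>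
      congrArg (fun z : Next (M E n) => z.1 t) (h3 n)))
  intro A _
  refine measure_congr ?_
  filter_upwards [h2] with ω hω
  change (X.X.ppInf ω ∈ A) = (Y.ppInf ω ∈ A)
  rw [hω]

/-! ### Closedness of the set of filtered processes -/

theorem isAdapted_const {E S : Type u} [TopologicalSpace E] [TopologicalSpace S]
    (ev : E → I → S) (B : FiltSpace.{v}) (x : E) :
    FRV.IsAdapted ev ⟨B, RV.const B x⟩ :=
  fun t => @measurable_const _ _ (borel S) (B.𝓕 t) (ev x t)

/-- A filtered random variable `X` with values in a path space is equivalent to a filtered process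
if and only if the conditional variances of its time integrals up to time `t`, given
`𝓕ᵣ` with `r ≥ t`, vanish. Where no càdlàg version of the conditional laws is available, `RV.pp` is
the prediction process of a deterministic random variable, and so is its class. -/
theorem IsPathSpace.mem_iff {E S : Type u} [TopologicalSpace E] [TopologicalSpace S]
    [TopologicalSpace.MetrizableSpace S] [SecondCountableTopology S] {ev : E → I → S}
    (h : IsPathSpace ev) (q : FR.{u, v} E) :
    (∃ X : FRV.{u, v} E, X.IsAdapted ev ∧ q = Quotient.mk (FRV.setoid E) X) ↔
      ∀ (φ : S →ᵇ ℝ) (s t : I), s ≤ t →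
        PM.integral (Next.variance (h.timeIntegral φ s t) t) (FR.lawPP1 q) = 0 := by
  constructor
  · rintro ⟨X, hX, rfl⟩ φ s t -
    change PM.integral _ X.X.pp.law = 0
    by_cases hp : ∃ Z : RV X.base (Next E), IsPrediction X.X Z
    · exact (RV.isPrediction_pp hp).integral_variance_eq_zero (h.measurable_timeIntegral hX φ s t)
    · obtain ⟨x, hx⟩ := RV.pp_eq_const hp
      rw [hx]
      exact (isPrediction_const X.base x).integral_variance_eq_zero
        (h.measurable_timeIntegral (isAdapted_const ev X.base x) φ s t)
  · induction q using Quotient.inductionOn with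
    | h X =>
      intro hq
      by_cases hp : ∃ Z : RV X.base (Next E), IsPrediction X.X Z
      · exact ⟨X, h.isAdapted_of_timeIntegral fun φ s t hst =>
          (RV.isPrediction_pp hp).measurable_of_variance
            (ae_variance_eq_zero_of_integral (hq φ s t hst)), rfl⟩
      -- Here `X` itself need not be adapted; the deterministic variable at `x` is an adapted
      -- representative of its class.
      · obtain ⟨x, hx⟩ := RV.pp_eq_const hp
        obtain ⟨ι, _, F, hF⟩ := h.exists_separating
        exact ⟨_, isAdapted_const ev X.base x, Quotient.sound (FRV.equiv_const hF hx)⟩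

theorem IsPathSpace.isClosed {E S : Type u} [TopologicalSpace E] [TopologicalSpace S]
    [TopologicalSpace.MetrizableSpace S] [SecondCountableTopology S] {ev : E → I → S}
    (h : IsPathSpace ev) :
    IsClosed[HK1.{u, v} E]
      {q | ∃ X : FRV.{u, v} E, X.IsAdapted ev ∧ q = Quotient.mk (FRV.setoid E) X} := by
  rw [isClosed_induced_iff]
  refine ⟨⋂ (φ : S →ᵇ ℝ) (s : I) (t : I) (_ : s ≤ t),
    {μ | PM.integral (Next.variance (h.timeIntegral φ s t) t) μ = 0}, ?_, ?_⟩
  · exact isClosed_iInter fun φ => isClosed_iInter fun s => isClosed_iInter fun t =>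
      isClosed_iInter fun _ => isClosed_eq (BoundedContinuousFunction.continuous _)
        continuous_const
  · ext q
    simp only [mem_preimage, mem_iInter]
    exact (h.mem_iff q).symm

theorem isPathSpace_DMZ (S : Type u) [TopologicalSpace S] :
    IsPathSpace (fun (f : DMZ S) t => f t) :=
  ⟨fun f => f.right_cont, Cadlag.toFun_injective, DMZ.continuous_integral⟩

theorem isPathSpace_DJ1 (S : Type u) [TopologicalSpace S] :
    IsPathSpace (fun (f : DJ1 S) t => f t) :=
  ⟨fun f => f.right_cont, Cadlag.toFun_injective, DJ1.continuous_integral⟩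

theorem isPathSpace_continuousMap (S : Type u) [TopologicalSpace S] :
    IsPathSpace (fun (f : C(I, S)) t => f t) :=
  ⟨fun f _ => f.continuous.continuousWithinAt, DFunLike.coe_injective,
    continuous_integral_continuousMap⟩

end AdaptedWeak

theorem mainTheorem10 {S : Type u} [TopologicalSpace S] (hS : AdaptedWeak.IsLusin S) :
    IsClosed[AdaptedWeak.HK1.{u, v} (AdaptedWeak.DMZ S)] (AdaptedWeak.FPMZ.{u, v} S) ∧
    IsClosed[AdaptedWeak.HK1.{u, v} (AdaptedWeak.DJ1 S)] (AdaptedWeak.FPJ1.{u, v} S) ∧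
    IsClosed[AdaptedWeak.HK1.{u, v} C(I, S)] (AdaptedWeak.FPCont.{u, v} S) := by
  obtain ⟨S', _, _, ι, hι, -⟩ := hS
  have := hι.metrizableSpace
  have := hι.secondCountableTopology
  exact ⟨(AdaptedWeak.isPathSpace_DMZ S).isClosed, (AdaptedWeak.isPathSpace_DJ1 S).isClosed,
    (AdaptedWeak.isPathSpace_continuousMap S).isClosed⟩
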